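/- For a positive integer $n$ and a set $D$ of divisors of $n$, all different from $n$, let $\mathrm{ICG}_n(D)$ be the graph with vertex set $\mathbb{Z}/n\mathbb{Z}$ in which $a$ and $b$ are adjacent if and only if $a-b$ is the class of an integer $k$ with $1\le k\le n-1$ and $\gcd(k,n)\in D$. A finite graph $G$ with adjacency matrix $A$ has perfect state transfer (PST) if there are distinct vertices $a,b$ and a real number $t>0$ such that $|\exp(\mathrm{i}tA)_{ab}|=1$. Theorem. Let $n$ be a positive integer divisible by $4$, and let $D$ be a set of divisors of $n$, all different from $n$, such that $n/2\notin D$ and $n/4\notin D$. Then $\mathrm{ICG}_n(D\cup\{n/4\})$ has PST if and only if $\mathrm{ICG}_n(D\cup\{n/2\})$ has PST. -/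

import Mathlib

open scoped Classical in
/-- A finite graph `G` has perfect state transfer if there are distinct vertices `a`, `b` and a
time `t > 0` with `|F(t)_{ab}| = 1`, where `F(t) = exp(i t A_G)` and `A_G` is the adjacency
matrix of `G`. -/
def HasPST {V : Type*} [Fintype V] (G : SimpleGraph V) : Prop :=
  ∃ a b : V, a ≠ b ∧ ∃ t : ℝ, 0 < t ∧
    ‖(NormedSpace.exp ((Complex.I * (t : ℂ)) • G.adjMatrix ℂ) : Matrix V V ℂ) a b‖ = 1

/-- `G_n(d) = {k : 1 ≤ k ≤ n - 1, gcd(k, n) = d}`, as a set of residues modulo `n`. -/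
def gcdClass (n d : ℕ) : Set (ZMod n) :=
  {x | ∃ k : ℕ, 1 ≤ k ∧ k ≤ n - 1 ∧ Nat.gcd k n = d ∧ x = (k : ZMod n)}

/-- The integral circulant graph `ICG_n(D)`: the circulant graph on `ℤ/nℤ` whose symbol is the
union of the sets `G_n(d)` for `d ∈ D`. -/
def ICG (n : ℕ) (D : Finset ℕ) : SimpleGraph (ZMod n) :=
  SimpleGraph.circulantGraph (⋃ d ∈ D, gcdClass n d)

/-! The eigenvalues of `ICG n D` are `λ_l = ∑ c_{n/d}(l)` over `d ∈ D`. PST holds at time `t`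
exactly when every difference `λ_{l+1} - λ_l` satisfies `exp(it(λ_{l+1} - λ_l)) = -1`
(`hasPST_icg_iff`); this forces the differences to be all odd, all `2` mod `4`, or all `0` mod `4`.
Adjoining `n/2` or `n/4` adds `c_2` or `c_4`, and either one shifts every difference by `2` mod `4`,
so both graphs obey the same criterion on `D`. The third case would need all differences of `D` to
be `2` mod `4`, which `exists_icgEigenvalue_succ_sub_mod_four_ne_two` excludes. -/

/-! ### Ramanujan sums modulo 4 -/

/-- The Ramanujan sum `c_N(l)`, the sum of the `l`-th powers of the primitive `N`-th roots of
unity, given by its divisor formula. -/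
def ramanujanSum (N l : ℕ) : ℤ :=
  ∑ x ∈ N.divisorsAntidiagonal, ArithmeticFunction.moebius x.1 * (if x.2 ∣ l then (x.2 : ℤ) else 0)

lemma sum_divisors_ramanujanSum {N : ℕ} (hN : 0 < N) (l : ℕ) :
    ∑ i ∈ N.divisors, ramanujanSum i l = if N ∣ l then (N : ℤ) else 0 :=
  (ArithmeticFunction.sum_eq_iff_sum_mul_moebius_eq (R := ℤ) (f := fun i => ramanujanSum i l)
    (g := fun N => if N ∣ l then (N : ℤ) else 0)).2 (fun _ _ => rfl) N hN

/-- Uniqueness in Möbius inversion, restricted to the divisors of a fixed `n`; it serves over `ZMod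
4` and over `ℂ`. -/
lemma eq_of_sum_divisors_eq {R : Type*} [AddCommGroup R] {f g : ℕ → R} {n : ℕ} (hn : n ≠ 0)
    (h : ∀ N, N ∣ n → ∑ i ∈ N.divisors, f i = ∑ i ∈ N.divisors, g i) :
    ∀ N, N ∣ n → f N = g N := by
  intro N
  induction N using Nat.strong_induction_on with
  | _ N ih =>
    intro hN
    have hN0 : N ≠ 0 := fun h0 => hn (by simpa [h0] using hN)
    have key := h N hN
    rw [← Nat.cons_self_properDivisors hN0, Finset.sum_cons, Finset.sum_cons] at key
    have : ∑ i ∈ N.properDivisors, f i = ∑ i ∈ N.properDivisors, g i :=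
      Finset.sum_congr rfl fun i hi => by
        rw [Nat.mem_properDivisors] at hi
        exact ih i hi.2 (hi.1.trans hN)
    rw [this] at key
    exact add_right_cancel key

lemma ramanujanSum_one (l : ℕ) : ramanujanSum 1 l = 1 := by
  simpa using sum_divisors_ramanujanSum one_pos l

lemma ramanujanSum_two (l : ℕ) : ramanujanSum 2 l = (if 2 ∣ l then 2 else 0) - 1 := by
  have h := sum_divisors_ramanujanSum two_pos l
  rw [show Nat.divisors 2 = {1, 2} by decide, Finset.sum_pair (by decide), ramanujanSum_one] at h
  push_cast at h
  linarith

lemma ramanujanSum_four (l : ℕ) :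
    ramanujanSum 4 l = (if 4 ∣ l then 4 else 0) - (if 2 ∣ l then 2 else 0) := by
  have h := sum_divisors_ramanujanSum four_pos l
  rw [show Nat.divisors 4 = {1, 2, 4} by decide, Finset.sum_insert (by decide),
    Finset.sum_pair (by decide), ramanujanSum_one, ramanujanSum_two] at h
  push_cast at h
  linarith

/-- As `l` grows from `0`, `c_2` cycles through `1, -1` and `c_4` through `2, 0, -2, 0`. -/
lemma ramanujanSum_succ_sub_mod_four {N : ℕ} (hN : N = 2 ∨ N = 4) (l : ℕ) :
    (ramanujanSum N (l + 1) - ramanujanSum N l) % 4 = 2 := by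
  rcases hN with rfl | rfl
  · rw [ramanujanSum_two, ramanujanSum_two]
    split_ifs <;> omega
  · rw [ramanujanSum_four, ramanujanSum_four]
    split_ifs <;> omega

/-- Modulo `4`, the Ramanujan sums of order other than `2` and `4` take the same value at `0` and
at the odd part of `n`. -/
lemma four_dvd_ramanujanSum_zero_sub {n m : ℕ} (hn : n ≠ 0) (hm : ∀ N, N ∣ n → (N ∣ m ↔ Odd N))
    {N : ℕ} (hN : N ∣ n) (h2 : N ≠ 2) (h4 : N ≠ 4) :
    (4 : ℤ) ∣ ramanujanSum N 0 - ramanujanSum N m := by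
  -- The divisor sum of the left side is `0` for odd `N` and `N` for even `N`; modulo `4` this is
  -- `2[2 ∣ N] + 2[4 ∣ N]`, the divisor sum of a function supported on `{2, 4}`.
  have key := eq_of_sum_divisors_eq (R := ZMod 4) (n := n)
    (f := fun i => ((ramanujanSum i 0 - ramanujanSum i m : ℤ) : ZMod 4))
    (g := fun i => (((if i = 2 then 2 else 0) + (if i = 4 then 2 else 0) : ℤ) : ZMod 4)) hn ?_ N hN
  · refine (ZMod.intCast_zmod_eq_zero_iff_dvd _ 4).1 ?_
    simpa [h2, h4] using key
  · intro N hN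
    have hN0 : 0 < N := Nat.pos_of_dvd_of_pos hN (Nat.pos_of_ne_zero hn)
    rw [← Int.cast_sum, ← Int.cast_sum, Finset.sum_sub_distrib, sum_divisors_ramanujanSum hN0,
      sum_divisors_ramanujanSum hN0, Finset.sum_add_distrib, Finset.sum_ite_eq',
      Finset.sum_ite_eq', if_pos (dvd_zero N), ZMod.intCast_eq_intCast_iff]
    simp only [Nat.mem_divisors, hm N hN, Nat.odd_iff, Int.ModEq]
    split_ifs <;> push_cast <;> omega

/-- The eigenvalue of `ICG n D` at the character `x ↦ exp (2πilx/n)`. -/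
def icgEigenvalue (n : ℕ) (D : Finset ℕ) (l : ℕ) : ℤ := ∑ d ∈ D, ramanujanSum (n / d) l

/-- Otherwise telescoping from `0` to the odd part `m` of `n` gives `λ_m - λ_0 ≡ 2m ≡ 2` mod `4`,
while every summand contributes `0`. -/
lemma exists_icgEigenvalue_succ_sub_mod_four_ne_two {n : ℕ} (hn0 : n ≠ 0)
    {D : Finset ℕ} (hD : D ⊆ n.properDivisors) (h2 : n / 2 ∉ D) (h4 : n / 4 ∉ D) :
    ∃ l, (icgEigenvalue n D (l + 1) - icgEigenvalue n D l) % 4 ≠ 2 := by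
  by_contra! h
  obtain ⟨k, m, hm, hkm⟩ := Nat.exists_eq_two_pow_mul_odd hn0
  have hdvd : ∀ N, N ∣ n → (N ∣ m ↔ Odd N) := fun N hN =>
    ⟨hm.of_dvd_nat, fun h =>
      (Nat.Coprime.pow_right k h.coprime_two_right).dvd_of_dvd_mul_left (hkm ▸ hN)⟩
  have h0 : (4 : ℤ) ∣ icgEigenvalue n D 0 - icgEigenvalue n D m := by
    rw [icgEigenvalue, icgEigenvalue, ← Finset.sum_sub_distrib]
    refine Finset.dvd_sum fun d hd => ?_
    have hdn := (Nat.mem_properDivisors.1 (hD hd)).1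
    refine four_dvd_ramanujanSum_zero_sub hn0 hdvd (Nat.div_dvd_of_dvd hdn) ?_ ?_
    · intro h
      exact h2 (by rwa [← h, Nat.div_div_self hdn hn0])
    · intro h
      exact h4 (by rwa [← h, Nat.div_div_self hdn hn0])
  have hl : ∀ l : ℕ, (icgEigenvalue n D l - icgEigenvalue n D 0) % 4
      = (2 * l) % 4 := by
    intro l
    induction l with
    | zero => simp
    | succ l ih =>
      have := h l
      push_cast
      omega
  have := hl m
  have := Nat.odd_iff.1 hm
  omega

/-! ### Ramanujan sums as character sums, and adjacency through gcds -/

/-- The multiples of `n / N` form a copy of `ZMod N`, where orthogonality of characters applies. -/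
lemma sum_stdAddChar_filter_dvd_val {n : ℕ} [NeZero n] {N : ℕ} (hN : N ∣ n) (l : ℕ) :
    ∑ x : ZMod n with n / N ∣ x.val, ZMod.stdAddChar ((l : ZMod n) * x) =
      ((if N ∣ l then (N : ℤ) else 0 : ℤ) : ℂ) := by
  have hN0 : N ≠ 0 := fun h => NeZero.ne n (by simpa [h] using hN)
  obtain ⟨e, rfl⟩ := hN
  have : NeZero N := ⟨hN0⟩
  have he : 0 < e := Nat.pos_of_ne_zero fun h => NeZero.ne (N * e) (by simp [h])
  rw [Nat.mul_div_cancel_left e (Nat.pos_of_ne_zero hN0)]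
  have hlt : ∀ k : ZMod N, e * k.val < N * e := fun k => by
    rw [mul_comm N]; exact Nat.mul_lt_mul_of_pos_left k.val_lt he
  have hsum : ∑ x : ZMod (N * e) with e ∣ x.val, ZMod.stdAddChar ((l : ZMod (N * e)) * x) =
      ∑ k : ZMod N, ZMod.stdAddChar (k * (l : ZMod N)) := by
    symm
    refine Finset.sum_bij' (fun k _ => ((e * k.val : ℕ) : ZMod (N * e)))
      (fun x _ => ((x.val / e : ℕ) : ZMod N)) ?_ ?_ ?_ ?_ ?_
    · intro k _
      simp [-Nat.cast_mul, ZMod.val_cast_of_lt (hlt k)]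
    · intro x _
      exact Finset.mem_univ _
    · intro k _
      simp [-Nat.cast_mul, ZMod.val_cast_of_lt (hlt k), Nat.mul_div_cancel_left _ he]
    · intro x hx
      have hx := (Finset.mem_filter.1 hx).2
      have : x.val / e < N := Nat.div_lt_of_lt_mul (x.val_lt.trans_eq (mul_comm N e))
      rw [ZMod.val_cast_of_lt this, Nat.mul_div_cancel' hx, ZMod.natCast_zmod_val]
    · intro k _
      have h1 := ZMod.stdAddChar_coe (N := N) ((k.val * l : ℕ) : ℤ)
      have h2 := ZMod.stdAddChar_coe (N := N * e) ((l * (e * k.val) : ℕ) : ℤ)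
      rw [Int.cast_natCast, Nat.cast_mul] at h1 h2
      rw [ZMod.natCast_zmod_val] at h1
      rw [h1, h2]
      congr 1
      have : (e : ℂ) ≠ 0 := by exact_mod_cast he.ne'
      have : (N : ℂ) ≠ 0 := by exact_mod_cast hN0
      push_cast
      field_simp
  rw [hsum, AddChar.sum_mulShift _ (ZMod.isPrimitive_stdAddChar N), ZMod.card]
  simp only [ZMod.natCast_eq_zero_iff]
  split_ifs <;> simp

lemma sum_stdAddChar_filter_gcd {n : ℕ} [NeZero n] (l : ℕ) {N : ℕ} (hN : N ∣ n) :
    ∑ x : ZMod n with x.val.gcd n = n / N, ZMod.stdAddChar ((l : ZMod n) * x) =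
      (ramanujanSum N l : ℂ) := by
  have hn := NeZero.ne n
  refine eq_of_sum_divisors_eq (R := ℂ) (n := n)
    (f := fun N => ∑ x : ZMod n with x.val.gcd n = n / N, ZMod.stdAddChar ((l : ZMod n) * x))
    (g := fun N => (ramanujanSum N l : ℂ)) hn ?_ N hN
  intro N hN
  have hN0 : 0 < N := Nat.pos_of_dvd_of_pos hN (Nat.pos_of_ne_zero hn)
  rw [← Int.cast_sum, sum_divisors_ramanujanSum hN0, ← sum_stdAddChar_filter_dvd_val hN]
  have hdvd : ∀ x : ZMod n, x.val.gcd n ∣ n := fun x => Nat.gcd_dvd_right _ _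
  -- Sort the multiples of `n / N` by their additive order `n / gcd(x, n)`, a divisor of `N`.
  rw [← Finset.sum_fiberwise_of_maps_to (s := {x : ZMod n | n / N ∣ x.val}) (t := N.divisors)
    (g := fun x => n / x.val.gcd n)]
  · refine Finset.sum_congr rfl fun i hi => ?_
    have hiN := (Nat.mem_divisors.1 hi).1
    rw [Finset.filter_filter]
    refine Finset.sum_congr (Finset.filter_congr fun x _ => ?_) fun _ _ => rfl
    constructor
    · intro h
      refine ⟨(Nat.div_dvd_div_left hN hiN).trans (h ▸ Nat.gcd_dvd_left _ _), ?_⟩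
      rw [h, Nat.div_div_self (hiN.trans hN) hn]
    · rintro ⟨-, h⟩
      rw [← h, Nat.div_div_self (hdvd x) hn]
  · intro x hx
    have hx := (Finset.mem_filter.1 hx).2
    rw [Nat.mem_divisors]
    refine ⟨?_, hN0.ne'⟩
    have h1 := Nat.div_dvd_div_left (hdvd x) (Nat.dvd_gcd hx (Nat.div_dvd_of_dvd hN))
    rwa [Nat.div_div_self hN hn] at h1

lemma sum_stdAddChar_filter_gcd_mem {n : ℕ} [NeZero n] {D : Finset ℕ} (hD : D ⊆ n.properDivisors)
    (l : ℕ) :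
    ∑ x : ZMod n with x.val.gcd n ∈ D, ZMod.stdAddChar ((l : ZMod n) * x) =
      (icgEigenvalue n D l : ℂ) := by
  rw [icgEigenvalue, Int.cast_sum,
    ← Finset.sum_fiberwise_of_maps_to (t := D) (g := fun x : ZMod n => x.val.gcd n)]
  · refine Finset.sum_congr rfl fun d hd => ?_
    have hdn := (Nat.mem_properDivisors.1 (hD hd)).1
    rw [← sum_stdAddChar_filter_gcd l (Nat.div_dvd_of_dvd hdn), Nat.div_div_self hdn (NeZero.ne n),
      Finset.filter_filter]
    refine Finset.sum_congr (Finset.filter_congr fun x _ => ?_) fun _ _ => rfl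
    exact ⟨And.right, fun h => ⟨h ▸ hd, h⟩⟩
  · intro x hx
    exact (Finset.mem_filter.1 hx).2

lemma gcd_val_neg {n : ℕ} [NeZero n] (x : ZMod n) : (-x).val.gcd n = x.val.gcd n := by
  rw [ZMod.neg_val]
  split_ifs with h
  · simp [h]
  · rw [Nat.gcd_self_sub_left x.val_lt.le]

lemma mem_gcdClass_iff {n d : ℕ} [NeZero n] (hd : d ∈ n.properDivisors) (x : ZMod n) :
    x ∈ gcdClass n d ↔ x.val.gcd n = d := by
  have hn := Nat.pos_of_ne_zero (NeZero.ne n)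
  constructor
  · rintro ⟨k, -, hk, h, rfl⟩
    rwa [ZMod.val_cast_of_lt (by omega)]
  · intro h
    have := x.val_lt
    refine ⟨x.val, ?_, by omega, h, (ZMod.natCast_zmod_val x).symm⟩
    by_contra! h0
    rw [Nat.lt_one_iff.1 h0, Nat.gcd_zero_left] at h
    exact (Nat.mem_properDivisors.1 hd).2.ne' h

lemma icg_adj_iff {n : ℕ} [NeZero n] {D : Finset ℕ} (hD : D ⊆ n.properDivisors) (a b : ZMod n) :
    (ICG n D).Adj a b ↔ (b - a).val.gcd n ∈ D := by
  have hmem : ∀ x : ZMod n, x ∈ (⋃ d ∈ D, gcdClass n d) ↔ x.val.gcd n ∈ D := by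
    intro x
    simp only [Set.mem_iUnion, exists_prop]
    constructor
    · rintro ⟨d, hd, h⟩
      rwa [(mem_gcdClass_iff (hD hd) x).1 h]
    · intro h
      exact ⟨_, h, (mem_gcdClass_iff (hD h) x).2 rfl⟩
  rw [ICG, SimpleGraph.circulantGraph_adj, hmem, hmem, ← neg_sub b a, gcd_val_neg, or_self,
    and_iff_right_iff_imp]
  rintro h rfl
  rw [sub_self, ZMod.val_zero, Nat.gcd_zero_left] at h
  exact (Nat.mem_properDivisors.1 (hD h)).2.false

/-! ### State transfer in an eigenbasis -/

lemma exp_mul_eq_mul_diagonal {V : Type*} [Fintype V] [DecidableEq V] {A U : Matrix V V ℂ}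
    {v : V → ℂ} (hU : IsUnit U) (h : A * U = U * Matrix.diagonal v) :
    NormedSpace.exp A * U = U * Matrix.diagonal (fun l => Complex.exp (v l)) := by
  have hdet : IsUnit U.det := (Matrix.isUnit_iff_isUnit_det U).1 hU
  have hA : A = U * Matrix.diagonal v * U⁻¹ := by
    rw [← h, Matrix.mul_nonsing_inv_cancel_right _ _ hdet]
  rw [hA, Matrix.exp_conj _ _ hU, Matrix.nonsing_inv_mul_cancel_right _ _ hdet,
    Matrix.exp_diagonal, Pi.exp_def, Complex.exp_eq_exp_ℂ]

lemma exp_mul_conjTranspose_eq_one {V : Type*} [Fintype V] [DecidableEq V] {A : Matrix V V ℂ}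
    (hA : A.IsHermitian) (t : ℝ) :
    NormedSpace.exp ((Complex.I * (t : ℂ)) • A) *
      (NormedSpace.exp ((Complex.I * (t : ℂ)) • A)).conjTranspose = 1 := by
  have h : ((Complex.I * (t : ℂ)) • A).conjTranspose = -((Complex.I * (t : ℂ)) • A) := by
    rw [Matrix.conjTranspose_smul, hA.eq, ← neg_smul]
    simp
  have hcomm : Commute ((Complex.I * (t : ℂ)) • A) (-((Complex.I * (t : ℂ)) • A)) := by
    rw [commute_iff_eq, Matrix.mul_neg, Matrix.neg_mul]
  rw [← Matrix.exp_conjTranspose, h, ← Matrix.exp_add_of_commute _ _ hcomm, add_neg_cancel, NormedSpace.exp_zero]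

/-- Perfect state transfer from `a` to `b` at time `t`, in terms of a basis of eigenvectors, the
columns of `U`. -/
lemma norm_exp_smul_apply_eq_one_iff {V : Type*} [Fintype V] [DecidableEq V] {A U : Matrix V V ℂ}
    {v : V → ℂ} (hA : A.IsHermitian) (hU : IsUnit U) (h : A * U = U * Matrix.diagonal v) (t : ℝ)
    (a b : V) :
    ‖(NormedSpace.exp ((Complex.I * (t : ℂ)) • A) : Matrix V V ℂ) a b‖ = 1 ↔
      ∃ z : ℂ, ‖z‖ = 1 ∧ ∀ l, Complex.exp (Complex.I * t * v l) * U a l = z * U b l := by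
  have hexp := exp_mul_eq_mul_diagonal (A := (Complex.I * (t : ℂ)) • A) (U := U)
    (v := fun l => Complex.I * t * v l) hU (by
      rw [Matrix.smul_mul, h, ← Matrix.mul_smul, ← Matrix.diagonal_smul]; rfl)
  have hunit := exp_mul_conjTranspose_eq_one hA t
  generalize NormedSpace.exp ((Complex.I * (t : ℂ)) • A) = F at hexp hunit ⊢
  have hrow : ∀ l, ∑ c, F a c * U c l = Complex.exp (Complex.I * t * v l) * U a l := by
    intro l
    have := congrFun (congrFun hexp a) l
    rwa [Matrix.mul_apply, Matrix.mul_diagonal, mul_comm (U a l)] at this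
  constructor
  · intro hab
    have hsum : ∑ c, ‖F a c‖ ^ 2 = 1 := by
      have := congrFun (congrFun hunit a) a
      simp only [Matrix.mul_apply, Matrix.conjTranspose_apply, Matrix.one_apply_eq,
        Complex.star_def, Complex.mul_conj'] at this
      exact_mod_cast this
    -- Row `a` of a unitary matrix has norm `1`, so an entry of modulus `1` leaves no room for the
    -- others.
    have hzero : ∀ c, c ≠ b → F a c = 0 := by
      rw [← Finset.add_sum_erase _ _ (Finset.mem_univ b), hab, one_pow, add_eq_left,
        Finset.sum_eq_zero_iff_of_nonneg fun _ _ => by positivity] at hsum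
      intro c hc
      simpa using hsum c (Finset.mem_erase.2 ⟨hc, Finset.mem_univ c⟩)
    refine ⟨F a b, hab, fun l => ?_⟩
    rw [← hrow, Finset.sum_eq_single b (fun c _ hc => by rw [hzero c hc, zero_mul]) (by simp)]
  · rintro ⟨z, hz, hl⟩
    have : Matrix.vecMul (F a) U = Matrix.vecMul (Pi.single b z) U := by
      ext l
      rw [Matrix.single_vecMul]
      exact (hrow l).trans (hl l)
    rw [Matrix.vecMul_injective_of_isUnit hU this, Pi.single_eq_same, hz]

/-! ### Diagonalisation by characters and the PST criterion -/

/-- The character table of `ℤ/nℤ`. -/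
noncomputable def charTable (n : ℕ) [NeZero n] : Matrix (ZMod n) (ZMod n) ℂ :=
  Matrix.of fun x l => ZMod.stdAddChar (l * x)

lemma isUnit_charTable (n : ℕ) [NeZero n] [DecidableEq (ZMod n)] : IsUnit (charTable n) := by
  have hn : (n : ℂ) ≠ 0 := NeZero.ne _
  refine IsUnit.of_mul_eq_one
    (Matrix.of fun l y => (n : ℂ)⁻¹ * ZMod.stdAddChar (-(l * y))) ?_
  ext x y
  simp only [charTable, Matrix.mul_apply, Matrix.of_apply, Matrix.one_apply]
  have : ∀ l : ZMod n, ZMod.stdAddChar (l * x) * ((n : ℂ)⁻¹ * ZMod.stdAddChar (-(l * y))) =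
      (n : ℂ)⁻¹ * ZMod.stdAddChar (l * (x - y)) := fun l => by
    rw [mul_sub, sub_eq_add_neg, AddChar.map_add_eq_mul]; ring
  simp only [this]
  rw [← Finset.mul_sum, AddChar.sum_mulShift _ (ZMod.isPrimitive_stdAddChar n), ZMod.card]
  simp only [sub_eq_zero]
  split_ifs <;> simp [hn]

lemma adjMatrix_icg_mul_charTable {n : ℕ} [NeZero n] [DecidableEq (ZMod n)] {D : Finset ℕ}
    [DecidableRel (ICG n D).Adj] (hD : D ⊆ n.properDivisors) :
    (ICG n D).adjMatrix ℂ * charTable n = charTable n * Matrix.diagonal fun l =>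
      ∑ x : ZMod n with x.val.gcd n ∈ D, ZMod.stdAddChar (l * x) := by
  ext a l
  rw [Matrix.mul_apply, Matrix.mul_diagonal]
  simp only [SimpleGraph.adjMatrix_apply, icg_adj_iff hD, charTable, Matrix.of_apply, ite_mul,
    one_mul, zero_mul]
  rw [Finset.sum_filter, Finset.mul_sum, ← Equiv.sum_comp (Equiv.addRight a)]
  refine Finset.sum_congr rfl fun x _ => ?_
  rw [Equiv.coe_addRight, add_sub_cancel_right, mul_add, AddChar.map_add_eq_mul]
  split_ifs
  · ring
  · simp

lemma stdAddChar_eq_neg_one {n : ℕ} [NeZero n] {c : ZMod n} (hc : c ≠ 0) (h : c + c = 0) :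
    ZMod.stdAddChar c = -1 := by
  have h1 : ZMod.stdAddChar c * ZMod.stdAddChar c = 1 := by
    rw [← AddChar.map_add_eq_mul, h, AddChar.map_zero_eq_one]
  refine (mul_self_eq_one_iff.1 h1).resolve_left fun h2 => hc (ZMod.injective_stdAddChar ?_)
  rw [h2, AddChar.map_zero_eq_one]

/-- Frees the definition from its classical decidability instances. -/
lemma hasPST_iff {V : Type*} [Fintype V] [i : DecidableEq V] (G : SimpleGraph V)
    [j : DecidableRel G.Adj] :
    HasPST G ↔ ∃ a b : V, a ≠ b ∧ ∃ t : ℝ, 0 < t ∧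
      ‖(NormedSpace.exp ((Complex.I * (t : ℂ)) • G.adjMatrix ℂ) : Matrix V V ℂ) a b‖ = 1 := by
  obtain rfl : i = fun a b => Classical.propDecidable (a = b) := Subsingleton.elim _ _
  obtain rfl : j = fun a b => Classical.propDecidable (G.Adj a b) := Subsingleton.elim _ _
  rfl

lemma hasPST_icg_iff {n : ℕ} [NeZero n] (hn : 2 ∣ n) {D : Finset ℕ} (hD : D ⊆ n.properDivisors) :
    HasPST (ICG n D) ↔ ∃ t : ℝ, 0 < t ∧ ∀ l : ℕ, Complex.exp (Complex.I * t *
      ((icgEigenvalue n D (l + 1) - icgEigenvalue n D l : ℤ) : ℂ)) = -1 := by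
  classical
  rw [hasPST_iff]
  have hval := sum_stdAddChar_filter_gcd_mem hD
  have hcast : ∀ l : ZMod n, ∃ k : ℕ, (k : ZMod n) = l := fun l => ⟨l.val, ZMod.natCast_zmod_val l⟩
  have hstep : ∀ (t : ℝ) (k : ℕ), Complex.exp (Complex.I * t *
      ((icgEigenvalue n D (k + 1) - icgEigenvalue n D k : ℤ) : ℂ)) *
      Complex.exp (Complex.I * t * icgEigenvalue n D k) =
      Complex.exp (Complex.I * t * icgEigenvalue n D (k + 1)) := fun t k => by
    rw [← Complex.exp_add]
    congr 1
    push_cast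
    ring
  constructor
  · rintro ⟨a, b, hab, t, ht, h⟩
    refine ⟨t, ht, ?_⟩
    obtain ⟨z, hz, h⟩ := (norm_exp_smul_apply_eq_one_iff (SimpleGraph.isHermitian_adjMatrix ℂ _)
      (isUnit_charTable n) (adjMatrix_icg_mul_charTable hD) t a b).1 h
    have hz0 : z ≠ 0 := by
      rintro rfl
      simp at hz
    have h' : ∀ l : ZMod n, Complex.exp (Complex.I * t *
        ∑ x : ZMod n with x.val.gcd n ∈ D, ZMod.stdAddChar (l * x)) =
        z * ZMod.stdAddChar (l * (b - a)) := by
      intro l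
      have := h l
      simp only [charTable, Matrix.of_apply] at this
      rw [mul_sub, sub_eq_add_neg, AddChar.map_add_eq_mul, ← mul_assoc, ← this, mul_assoc (Complex.exp _),
        ← AddChar.map_add_eq_mul, add_neg_cancel, AddChar.map_zero_eq_one, mul_one]
    -- The connection set is symmetric, so `λ_{-1} = λ_1`. This forces `2(b - a) = 0`, hence the
    -- character value at `b - a` is `-1`.
    have hsymm : ∑ x : ZMod n with x.val.gcd n ∈ D, ZMod.stdAddChar (-1 * x) =
        ∑ x : ZMod n with x.val.gcd n ∈ D, ZMod.stdAddChar (1 * x) := by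
      rw [Finset.sum_filter, Finset.sum_filter, ← Equiv.sum_comp (Equiv.neg _)]
      simp [gcd_val_neg]
    have hc : ZMod.stdAddChar (b - a) = (-1 : ℂ) := by
      refine stdAddChar_eq_neg_one (sub_ne_zero.2 hab.symm) ?_
      have h1 := h' (-1)
      rw [hsymm, h' 1] at h1
      have h2 := ZMod.injective_stdAddChar (mul_left_cancel₀ hz0 h1)
      rw [one_mul, neg_one_mul] at h2
      exact add_eq_zero_iff_eq_neg.2 h2
    have hk : ∀ k : ℕ, Complex.exp (Complex.I * t * icgEigenvalue n D k) = z * (-1) ^ k := by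
      intro k
      rw [← hval, h', ← nsmul_eq_mul, AddChar.map_nsmul_eq_pow, hc]
    intro k
    have h1 := hstep t k
    rw [hk, hk, pow_succ, ← mul_assoc z, mul_comm _ (-1 : ℂ)] at h1
    exact mul_right_cancel₀ (mul_ne_zero hz0 (pow_ne_zero _ (by norm_num))) h1
  · rintro ⟨t, ht, h⟩
    obtain ⟨m, hm⟩ := hn
    have hn0 := NeZero.ne n
    have hc : (m : ZMod n) ≠ 0 := by
      rw [Ne, ZMod.natCast_eq_zero_iff]
      intro h0
      have := Nat.le_of_dvd (by omega) h0
      omega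
    have hchar : ZMod.stdAddChar (m : ZMod n) = (-1 : ℂ) := by
      refine stdAddChar_eq_neg_one hc ?_
      rw [← two_mul, ← Nat.cast_two, ← Nat.cast_mul, ← hm, ZMod.natCast_self]
    -- Transfer goes from `0` to the element `m = n / 2` of order two.
    refine ⟨0, m, hc.symm, t, ht,
      (norm_exp_smul_apply_eq_one_iff (SimpleGraph.isHermitian_adjMatrix ℂ _)
        (isUnit_charTable n) (adjMatrix_icg_mul_charTable hD) t 0 m).2 ⟨Complex.exp (Complex.I * t * icgEigenvalue n D 0), ?_, fun l => ?_⟩⟩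
    · rw [Complex.norm_exp]
      simp
    · obtain ⟨k, rfl⟩ := hcast l
      simp only [charTable, Matrix.of_apply]
      rw [hval, mul_zero, AddChar.map_zero_eq_one, mul_one, ← nsmul_eq_mul,
        AddChar.map_nsmul_eq_pow, hchar]
      induction k with
      | zero => simp
      | succ k ih => rw [← hstep, h, ih, pow_succ]; ring

/-! ### Parity of eigenvalue differences and conclusion -/

/-- Raising the two exponentials to the powers `y` and `x` gives the same number, so `(-1)^y =
(-1)^x`. -/
lemma even_iff_of_exp_eq_neg_one {t : ℝ} {d e x y : ℤ}
    (hd : Complex.exp (Complex.I * t * d) = -1) (he : Complex.exp (Complex.I * t * e) = -1)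
    (h : d * y = e * x) : Even x ↔ Even y := by
  have hpow : (-1 : ℂ) ^ y = (-1) ^ x := by
    rw [← hd, ← Complex.exp_int_mul, hd, ← he, ← Complex.exp_int_mul]
    congr 1
    have : (d : ℂ) * y = e * x := by exact_mod_cast h
    linear_combination Complex.I * t * this
  have hiff : ∀ k : ℤ, Even k ↔ (-1 : ℂ) ^ k = 1 := fun k => by
    refine ⟨Even.neg_one_zpow, fun hk => ?_⟩
    by_contra hodd
    rw [(Int.not_even_iff_odd.1 hodd).neg_one_zpow] at hk
    norm_num at hk
  rw [hiff, hiff, hpow]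

/-- Integers whose exponentials at a common time are all `-1` have the same `2`-adic valuation. -/
lemma forall_odd_or_mod_four_of_exp_eq_neg_one {ι : Type*} {d : ι → ℤ} {t : ℝ}
    (h : ∀ i, Complex.exp (Complex.I * t * d i) = -1) :
    (∀ i, d i % 2 = 1) ∨ (∀ i, d i % 4 = 2) ∨ ∀ i, d i % 4 = 0 := by
  by_cases h1 : ∃ i, d i % 2 = 1
  · obtain ⟨i, hi⟩ := h1
    refine Or.inl fun j => ?_
    have := even_iff_of_exp_eq_neg_one (h i) (h j) (mul_comm (d i) (d j))
    rw [Int.even_iff, Int.even_iff] at this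
    omega
  push Not at h1
  refine Or.inr ?_
  by_cases h2 : ∃ i, d i % 4 = 2
  · obtain ⟨i, hi⟩ := h2
    refine Or.inl fun j => ?_
    have hi' : d i = 2 * (d i / 2) := by omega
    have hj' : d j = 2 * (d j / 2) := by have := h1 j; omega
    -- Halving both integers keeps the proportion, so the halves have equal parity.
    have := even_iff_of_exp_eq_neg_one (x := d i / 2) (y := d j / 2) (h i) (h j) (by
      calc d i * (d j / 2) = 2 * (d i / 2) * (d j / 2) := by rw [← hi']
        _ = 2 * (d j / 2) * (d i / 2) := by ring
        _ = d j * (d i / 2) := by rw [← hj'])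
    rw [Int.even_iff, Int.even_iff] at this
    omega
  · push Not at h2
    exact Or.inr fun i => by have := h1 i; have := h2 i; omega

lemma exp_I_mul_pi_mul_of_odd {d : ℤ} (hd : Odd d) :
    Complex.exp (Complex.I * Real.pi * d) = -1 := by
  rw [mul_comm, Complex.exp_int_mul, mul_comm, Complex.exp_pi_mul_I, hd.neg_one_zpow]

lemma hasPST_icg_union_iff {n : ℕ} [NeZero n] (hn : 4 ∣ n) {D : Finset ℕ}
    (hD : D ⊆ n.properDivisors) (h2 : n / 2 ∉ D) (h4 : n / 4 ∉ D) {N : ℕ} (hN : N = 2 ∨ N = 4) :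
    HasPST (ICG n (D ∪ {n / N})) ↔
      (∀ l, (icgEigenvalue n D (l + 1) - icgEigenvalue n D l) % 2 = 1) ∨
        ∀ l, (icgEigenvalue n D (l + 1) - icgEigenvalue n D l) % 4 = 0 := by
  have hn0 := NeZero.ne n
  have hNn : N ∣ n := by rcases hN with rfl | rfl <;> omega
  have hND : n / N ∉ D := by rcases hN with rfl | rfl <;> assumption
  have hprop : D ∪ {n / N} ⊆ n.properDivisors := by
    refine Finset.union_subset hD (Finset.singleton_subset_iff.2 (Nat.mem_properDivisors.2
      ⟨Nat.div_dvd_of_dvd hNn, Nat.div_lt_self (by omega) (by omega)⟩))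
  have hstep : ∀ l, (icgEigenvalue n (D ∪ {n / N}) (l + 1) - icgEigenvalue n (D ∪ {n / N}) l) % 4 =
      (icgEigenvalue n D (l + 1) - icgEigenvalue n D l + 2) % 4 := by
    intro l
    have := ramanujanSum_succ_sub_mod_four hN l
    simp only [icgEigenvalue, Finset.sum_union (Finset.disjoint_singleton_right.2 hND),
      Finset.sum_singleton, Nat.div_div_self hNn hn0]
    omega
  rw [hasPST_icg_iff (by omega) hprop]
  constructor
  · rintro ⟨t, -, h⟩
    rcases forall_odd_or_mod_four_of_exp_eq_neg_one h with h | h | h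
    · exact Or.inl fun l => by have := h l; have := hstep l; omega
    · exact Or.inr fun l => by have := h l; have := hstep l; omega
    · obtain ⟨l, hl⟩ := exists_icgEigenvalue_succ_sub_mod_four_ne_two hn0 hD h2 h4
      have := h l
      have := hstep l
      omega
  · rintro (h | h)
    · refine ⟨Real.pi, Real.pi_pos, fun l => exp_I_mul_pi_mul_of_odd ?_⟩
      rw [Int.odd_iff]
      have := h l
      have := hstep l
      omega
    -- After the shift by `2` each difference is twice an odd number, so half of the time `π`
    -- suffices.
    · refine ⟨Real.pi / 2, by positivity, fun l => ?_⟩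
      have h1 := h l
      have h2 := hstep l
      generalize icgEigenvalue n (D ∪ {n / N}) (l + 1) - icgEigenvalue n (D ∪ {n / N}) l = d at h2 ⊢
      obtain ⟨e, rfl⟩ : ∃ e, d = 2 * e := ⟨d / 2, by omega⟩
      rw [← exp_I_mul_pi_mul_of_odd (d := e) (Int.odd_iff.2 (by omega))]
      congr 1
      push_cast
      ring

theorem mainTheorem5 (n : ℕ) [NeZero n] (hn : 4 ∣ n) (D : Finset ℕ)
    (hD : D ⊆ n.properDivisors) (h2 : n / 2 ∉ D) (h4 : n / 4 ∉ D) :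
    HasPST (ICG n (D ∪ {n / 4})) ↔ HasPST (ICG n (D ∪ {n / 2})) := by
  rw [hasPST_icg_union_iff hn hD h2 h4 (Or.inr rfl), hasPST_icg_union_iff hn hD h2 h4 (Or.inl rfl)]
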